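/- Let $A$ be an associative ring with unit and let $\mathfrak C$ be an $A$-coring, i.e. an $A$-bimodule with $A$-bilinear maps $\Delta_{\mathfrak C}:\mathfrak C\to\mathfrak C\otimes_A\mathfrak C$ and $\varepsilon_{\mathfrak C}:\mathfrak C\to A$ that are coassociative and counital. Let $R$ be a firm ring, i.e. a ring, not necessarily with unit, whose multiplication map $R\otimes_R R\to R$ is bijective. Let $\Sigma$ be an $R$-$A$-bimodule with a right $\mathfrak C$-comodule structure $\rho:\Sigma\to\Sigma\otimes_A\mathfrak C$, $\rho(u)=u_{[0]}\otimes_A u_{[1]}$ (right $A$-linear, coassociative, counital), that is left $R$-linear. Put $\Sigma^*=\mathrm{Hom}_A(\Sigma,A)$, and regard $\Sigma\otimes_A\Sigma^*$ as a (non-unital) ring with multiplication $(u\otimes\varphi)(v\otimes\psi)=u\varphi(v)\otimes\psi$, acting on $\Sigma$ by $(u\otimes\varphi)v=u\varphi(v)$. For a right $A$-module $M$, let $R$ act on the right of $\mathrm{Hom}_A(\Sigma,M)$ by $(fr)(u)=f(ru)$. Assume that $\Sigma$ is $R$-firmly projective: there is a ring morphism $\iota:R\to\Sigma\otimes_A\Sigma^*$,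 written $\iota(r)=e_r\otimes_A f_r$ (summation understood), which induces the given action of $R$ on $\Sigma$, and $\Sigma$ is a firm left $R$-module, i.e. the multiplication map $R\otimes_R\Sigma\to\Sigma$ is bijective. Write its inverse as $u\mapsto r\otimes_R u^r$. Then $\Sigma^*\otimes_R\Sigma$ is an $A$-coring (the comatrix coring) with $$\Delta(\varphi\otimes_R u)=(\varphi\otimes_R e_r)\otimes_A(f_r\otimes_R u^r),\qquad \varepsilon(\varphi\otimes_R u)=\varphi(u).$$ The following are equivalent: (i) $\Sigma$ is an $R$-$\mathfrak C$ Galois comodule, i.e. the canonical map $$\mathsf{can}:\Sigma^*\otimes_R\Sigma\to\mathfrak C,\qquad \mathsf{can}(f\otimes_R u)=f(u_{[0]})u_{[1]},$$ is an isomorphism of $A$-corings; (ii) $\Sigma$ is an $R$-$\mathfrak C$ comonadic-Galois comodule, i.e. for every right $A$-module $M$ the map $$\mathsf{can}_M:\mathrm{Hom}_A(\Sigma,M)\otimes_R\Sigma\to M\otimes_A\mathfrak C,\qquad \mathsf{can}_M(f\otimes_R u)=f(u_{[0]})\otimes_A u_{[1]},$$ is an isomorphism. -/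

import Mathlib

open scoped TensorProduct
open MulOpposite


namespace FirmGalois

/-! ### Balanced tensor products over an arbitrary (non-commutative, possibly non-unital) ring

Right actions of `S` are written as actions of `Sᵐᵒᵖ`, so `op s • m` is the product `m s`. -/

section Balanced

universe s v w

variable (S : Type s) (M : Type v) (N : Type w) [AddCommGroup M] [AddCommGroup N]
  [SMul Sᵐᵒᵖ M] [SMul S N]

/-- The subgroup of `M ⊗[ℤ] N` generated by all `m s ⊗ n - m ⊗ s n`. -/
def balancedRel : AddSubgroup (M ⊗[ℤ] N) :=
  AddSubgroup.closure
    {x | ∃ (s : S) (m : M) (n : N), x = (op s • m) ⊗ₜ[ℤ] n - m ⊗ₜ[ℤ] (s • n)}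

/-- The tensor product `M ⊗_S N` of a right `S`-module `M` and a left `S`-module `N`. -/
def BTensor : Type (max v w) := (M ⊗[ℤ] N) ⧸ balancedRel S M N

instance : AddCommGroup (BTensor S M N) :=
  inferInstanceAs (AddCommGroup ((M ⊗[ℤ] N) ⧸ balancedRel S M N))

/-- The canonical projection `M ⊗[ℤ] N → M ⊗_S N`. -/
def bproj : M ⊗[ℤ] N →+ BTensor S M N := QuotientAddGroup.mk' (balancedRel S M N)

variable {M N}

/-- The pure tensor `m ⊗_S n`. -/
def btmul (m : M) (n : N) : BTensor S M N :=
  bproj S M N (m ⊗ₜ[ℤ] n)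

theorem btmul_balanced (s : S) (m : M) (n : N) :
    btmul S (op s • m) n = btmul S m (s • n) := by
  rw [← sub_eq_zero]
  unfold btmul
  rw [← map_sub]
  exact (QuotientAddGroup.eq_zero_iff _).2 (AddSubgroup.subset_closure ⟨s, m, n, rfl⟩)

theorem add_btmul (m m' : M) (n : N) :
    btmul S (m + m') n = btmul S m n + btmul S m' n := by
  unfold btmul
  rw [TensorProduct.add_tmul, map_add]

theorem btmul_add (m : M) (n n' : N) :
    btmul S m (n + n') = btmul S m n + btmul S m n' := by
  unfold btmul
  rw [TensorProduct.tmul_add, map_add]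

theorem btmul_zero (m : M) : btmul S m (0 : N) = 0 := by
  unfold btmul
  rw [TensorProduct.tmul_zero, map_zero]

theorem zero_btmul (n : N) : btmul S (0 : M) n = 0 := by
  unfold btmul
  rw [TensorProduct.zero_tmul, map_zero]

theorem btensor_induction {p : BTensor S M N → Prop} (x : BTensor S M N)
    (h0 : p 0) (ht : ∀ m n, p (btmul S m n)) (ha : ∀ x y, p x → p y → p (x + y)) : p x := by
  obtain ⟨y, rfl⟩ : ∃ y, bproj S M N y = x :=
    QuotientAddGroup.mk'_surjective (balancedRel S M N) x
  induction y with
  | zero => rw [map_zero]; exact h0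
  | tmul m n => exact ht m n
  | add a b iha ihb => rw [map_add]; exact ha _ _ iha ihb

variable {P : Type*} [AddCommGroup P]

/-- The universal property of `M ⊗_S N`. -/
def blift (f : M → N → P) (hl : ∀ m m' n, f (m + m') n = f m n + f m' n)
    (hr : ∀ m n n', f m (n + n') = f m n + f m n')
    (hb : ∀ (s : S) m n, f (op s • m) n = f m (s • n)) : BTensor S M N →+ P :=
  QuotientAddGroup.lift (balancedRel S M N)
    (TensorProduct.liftAddHom (R := ℤ)
      (AddMonoidHom.mk' (fun m => AddMonoidHom.mk' (f m) (hr m))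
        (fun m m' => by ext n; exact hl m m' n))
      (fun z m n => by rw [map_zsmul, map_zsmul]; rfl))
    (by
      unfold balancedRel
      rw [AddSubgroup.closure_le]
      rintro _ ⟨s, m, n, rfl⟩
      have h := hb s m n
      simp only [SetLike.mem_coe, AddMonoidHom.mem_ker, map_sub,
        TensorProduct.liftAddHom_tmul, AddMonoidHom.mk'_apply, h, sub_self])

@[simp]
theorem blift_btmul (f : M → N → P) (hl hr) (hb : ∀ (s : S) m n, f (op s • m) n = f m (s • n))
    (m : M) (n : N) : blift S f hl hr hb (btmul S m n) = f m n := rfl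

theorem btensor_hom_ext {f g : BTensor S M N →+ P}
    (h : ∀ m n, f (btmul S m n) = g (btmul S m n)) : f = g := by
  ext x
  induction x using btensor_induction with
  | h0 => simp
  | ht m n => exact h m n
  | ha x y hx hy => rw [map_add, map_add, hx, hy]

end Balanced

section Actions

variable (S : Type*) {M N T : Type*} [AddCommGroup M] [AddCommGroup N]
  [SMul Sᵐᵒᵖ M] [SMul S N] [Ring T]

/-- If `M` is a `T`-`S`-bimodule, then `M ⊗_S N` is a left `T`-module, `t (m ⊗ n) = t m ⊗ n`. -/
instance leftModule [Module T M] [SMulCommClass T Sᵐᵒᵖ M] : Module T (BTensor S M N) where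
  smul t := blift S (fun m n => btmul S (t • m) n)
    (fun m m' n => by rw [smul_add, add_btmul]) (fun m n n' => btmul_add S _ n n')
    (fun s m n => by rw [smul_comm, btmul_balanced])
  one_smul x := by
    change blift S _ _ _ _ x = x
    induction x using btensor_induction with
    | h0 => simp
    | ht m n => simp
    | ha x y hx hy => rw [map_add, hx, hy]
  mul_smul t t' x := by
    change blift S _ _ _ _ x = blift S _ _ _ _ (blift S _ _ _ _ x)
    induction x using btensor_induction with
    | h0 => simp
    | ht m n => simp [mul_smul]
    | ha x y hx hy => simp only [map_add, hx, hy]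
  smul_zero t := map_zero (blift S _ _ _ _)
  smul_add t x y := map_add (blift S _ _ _ _) x y
  add_smul t t' x := by
    change blift S _ _ _ _ x = blift S _ _ _ _ x + blift S _ _ _ _ x
    induction x using btensor_induction with
    | h0 => simp
    | ht m n => simp [add_smul, add_btmul]
    | ha x y hx hy => simp only [map_add, hx, hy]; abel
  zero_smul x := by
    change blift S _ _ _ _ x = 0
    induction x using btensor_induction with
    | h0 => simp
    | ht m n =>
      rw [blift_btmul, zero_smul, zero_btmul]
    | ha x y hx hy => rw [map_add, hx, hy, add_zero]

/-- If `N` is an `S`-`T`-bimodule, then `M ⊗_S N` is a right `T`-module, `(m ⊗ n) t = m ⊗ n t`. -/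
instance rightModule [Module Tᵐᵒᵖ N] [SMulCommClass S Tᵐᵒᵖ N] :
    Module Tᵐᵒᵖ (BTensor S M N) where
  smul t := blift S (fun m n => btmul S m (t • n))
    (fun m m' n => add_btmul S m m' _) (fun m n n' => by rw [smul_add, btmul_add])
    (fun s m n => by rw [btmul_balanced, smul_comm])
  one_smul x := by
    change blift S _ _ _ _ x = x
    induction x using btensor_induction with
    | h0 => simp
    | ht m n => simp
    | ha x y hx hy => rw [map_add, hx, hy]
  mul_smul t t' x := by
    change blift S _ _ _ _ x = blift S _ _ _ _ (blift S _ _ _ _ x)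
    induction x using btensor_induction with
    | h0 => simp
    | ht m n => simp [mul_smul]
    | ha x y hx hy => simp only [map_add, hx, hy]
  smul_zero t := map_zero (blift S _ _ _ _)
  smul_add t x y := map_add (blift S _ _ _ _) x y
  add_smul t t' x := by
    change blift S _ _ _ _ x = blift S _ _ _ _ x + blift S _ _ _ _ x
    induction x using btensor_induction with
    | h0 => simp
    | ht m n => simp [add_smul, btmul_add]
    | ha x y hx hy => simp only [map_add, hx, hy]; abel
  zero_smul x := by
    change blift S _ _ _ _ x = 0
    induction x using btensor_induction with
    | h0 => simp
    | ht m n =>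
      rw [blift_btmul, zero_smul, btmul_zero]
    | ha x y hx hy => rw [map_add, hx, hy, add_zero]

theorem smul_btmul [Module T M] [SMulCommClass T Sᵐᵒᵖ M] (t : T) (m : M) (n : N) :
    t • btmul S m n = btmul S (t • m) n := rfl

theorem op_smul_btmul [Module Tᵐᵒᵖ N] [SMulCommClass S Tᵐᵒᵖ N] (t : T) (m : M) (n : N) :
    op t • btmul S m n = btmul S m (op t • n) := rfl

instance {T' : Type*} [Ring T'] [Module T M] [SMulCommClass T Sᵐᵒᵖ M]
    [Module T'ᵐᵒᵖ N] [SMulCommClass S T'ᵐᵒᵖ N] :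
    SMulCommClass T T'ᵐᵒᵖ (BTensor S M N) where
  smul_comm t t' x := by
    induction x using btensor_induction with
    | h0 => simp only [smul_zero]
    | ht m n => rfl
    | ha x y hx hy => simp only [smul_add, hx, hy]

end Actions

/-! ### Tensor products over a unital ring `A` -/

section Unital

/-- The tensor product `M ⊗_A N` of unital modules over a unital ring `A`. -/
abbrev ATensor (A M N : Type*) [Ring A] [AddCommGroup M] [AddCommGroup N]
    [Module Aᵐᵒᵖ M] [Module A N] : Type _ := BTensor A M N

variable {A : Type*} [Ring A]
variable {M M' M'' N N' N'' : Type*}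
  [AddCommGroup M] [AddCommGroup M'] [AddCommGroup M'']
  [AddCommGroup N] [AddCommGroup N'] [AddCommGroup N'']
  [Module Aᵐᵒᵖ M] [Module Aᵐᵒᵖ M'] [Module Aᵐᵒᵖ M'']
  [Module A N] [Module A N'] [Module A N'']

/-- The map `f ⊗_A g` for a right `A`-linear `f` and a left `A`-linear `g`. -/
def bmap (f : M →ₗ[Aᵐᵒᵖ] M') (g : N →ₗ[A] N') : ATensor A M N →+ ATensor A M' N' :=
  blift A (fun m n => btmul A (f m) (g n))
    (fun m m' n => by rw [map_add, add_btmul]) (fun m n n' => by rw [map_add, btmul_add])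
    (fun a m n => by rw [map_smul, map_smul, btmul_balanced])

@[simp]
theorem bmap_btmul (f : M →ₗ[Aᵐᵒᵖ] M') (g : N →ₗ[A] N') (m : M) (n : N) :
    bmap f g (btmul A m n) = btmul A (f m) (g n) := rfl

/-- The canonical map `(M ⊗_A X) ⊗_A N → M ⊗_A (X ⊗_A N)`, `(m ⊗ x) ⊗ n ↦ m ⊗ (x ⊗ n)`. -/
def bassoc (M X N : Type*) [AddCommGroup M] [AddCommGroup X] [AddCommGroup N]
    [Module Aᵐᵒᵖ M] [Module A X] [Module Aᵐᵒᵖ X] [SMulCommClass A Aᵐᵒᵖ X] [Module A N] :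
    ATensor A (ATensor A M X) N →+ ATensor A M (ATensor A X N) :=
  blift A
    (fun z n => blift A (fun m x => btmul A m (btmul A x n))
      (fun m m' x => add_btmul A m m' _)
      (fun m x x' => by rw [add_btmul, btmul_add])
      (fun a m x => by rw [btmul_balanced, smul_btmul]) z)
    (fun z z' n => map_add _ z z')
    (fun z n n' => by
      induction z using btensor_induction with
      | h0 => simp
      | ht m x => simp [btmul_add]
      | ha x y hx hy => simp only [map_add, hx, hy]; abel)
    (fun a z n => by
      induction z using btensor_induction with
      | h0 => simp
      | ht m x => simp [op_smul_btmul, btmul_balanced]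
      | ha x y hx hy => simp only [smul_add, map_add, hx, hy])

@[simp]
theorem bassoc_btmul {X : Type*} [AddCommGroup X] [Module A X] [Module Aᵐᵒᵖ X]
    [SMulCommClass A Aᵐᵒᵖ X] (m : M) (x : X) (n : N) :
    bassoc (A := A) M X N (btmul A (btmul A m x) n) = btmul A m (btmul A x n) := rfl

/-- The canonical map `A ⊗_A N → N`, `a ⊗ n ↦ a n`. -/
def lunit (N : Type*) [AddCommGroup N] [Module A N] : ATensor A A N →+ N :=
  blift A (fun a n => a • n) (fun a a' n => add_smul a a' n) (fun a n n' => smul_add a n n')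
    (fun s a n => by rw [op_smul_eq_mul, mul_smul])

@[simp]
theorem lunit_btmul (a : A) (n : N) : lunit (A := A) N (btmul A a n) = a • n := rfl

/-- The canonical map `M ⊗_A A → M`, `m ⊗ a ↦ m a`. -/
def runit (M : Type*) [AddCommGroup M] [Module Aᵐᵒᵖ M] : ATensor A M A →+ M :=
  blift A (fun m a => op a • m) (fun m m' a => smul_add _ m m')
    (fun m a a' => by rw [op_add, add_smul])
    (fun s m a => by rw [smul_eq_mul, op_mul, mul_smul])

@[simp]
theorem runit_btmul (m : M) (a : A) : runit (A := A) M (btmul A m a) = op a • m := rfl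

end Unital

/-! ### Bimodule maps, corings, comodules -/

/-- `A`-bilinear maps between `A`-bimodules. -/
structure BimodHom (A M N : Type*) [Ring A] [AddCommGroup M] [AddCommGroup N]
    [Module A M] [Module Aᵐᵒᵖ M] [Module A N] [Module Aᵐᵒᵖ N] extends M →ₗ[A] N where
  map_op_smul' : ∀ (a : A) (m : M), toFun (op a • m) = op a • toFun m

namespace BimodHom

variable {A M N : Type*} [Ring A] [AddCommGroup M] [AddCommGroup N]
    [Module A M] [Module Aᵐᵒᵖ M] [Module A N] [Module Aᵐᵒᵖ N]

instance : CoeFun (BimodHom A M N) (fun _ => M → N) := ⟨fun f => f.toFun⟩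

theorem map_zero (f : BimodHom A M N) : f 0 = 0 := _root_.map_zero f.toLinearMap

theorem map_add (f : BimodHom A M N) (x y : M) : f (x + y) = f x + f y :=
  _root_.map_add f.toLinearMap x y

/-- The underlying left `A`-linear map. -/
abbrev left (f : BimodHom A M N) : M →ₗ[A] N := f.toLinearMap

/-- The underlying right `A`-linear map. -/
def right (f : BimodHom A M N) : M →ₗ[Aᵐᵒᵖ] N where
  toFun := f
  map_add' := f.map_add'
  map_smul' a m := f.map_op_smul' (unop a) m

end BimodHom

section Corings

variable (A : Type*) [Ring A] (C : Type*) [AddCommGroup C] [Module A C] [Module Aᵐᵒᵖ C]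
  [SMulCommClass A Aᵐᵒᵖ C]

/-- The structure of an `A`-coring on an `A`-bimodule `C`. -/
structure Coring where
  /-- comultiplication -/
  comul : BimodHom A C (ATensor A C C)
  /-- counit -/
  counit : BimodHom A C A
  coassoc : ∀ c, bassoc (A := A) C C C (bmap comul.right LinearMap.id (comul c)) =
    bmap LinearMap.id comul.left (comul c)
  counit_left : ∀ c, lunit (A := A) C (bmap counit.right LinearMap.id (comul c)) = c
  counit_right : ∀ c, runit (A := A) C (bmap LinearMap.id counit.left (comul c)) = c

variable {A C}

/-- The structure of a right `𝒞`-comodule on a right `A`-module `X`. -/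
structure Comodule (𝒞 : Coring A C) (X : Type*) [AddCommGroup X] [Module Aᵐᵒᵖ X] where
  /-- coaction -/
  coact : X →ₗ[Aᵐᵒᵖ] ATensor A X C
  coassoc : ∀ x, bassoc (A := A) X C C (bmap coact LinearMap.id (coact x)) =
    bmap LinearMap.id 𝒞.comul.left (coact x)
  counit : ∀ x, runit (A := A) X (bmap LinearMap.id 𝒞.counit.left (coact x)) = x

/-- A bimodule map `f` between corings is a morphism of corings. -/
structure IsCoringHom {D : Type*} [AddCommGroup D] [Module A D] [Module Aᵐᵒᵖ D]
    [SMulCommClass A Aᵐᵒᵖ D] (𝒟 : Coring A D) (𝒞 : Coring A C) (f : BimodHom A D C) : Prop where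
  map_comul : ∀ d, 𝒞.comul (f d) = bmap f.right f.left (𝒟.comul d)
  map_counit : ∀ d, 𝒞.counit (f d) = 𝒟.counit d

end Corings

/-! ### Firm rings and firm modules -/

/-- Left modules over a ring without unit. -/
class NonUnitalModule (R M : Type*) [NonUnitalRing R] [AddCommGroup M] extends SMul R M where
  protected smul_add : ∀ (r : R) (m m' : M), r • (m + m') = r • m + r • m'
  protected add_smul : ∀ (r r' : R) (m : M), (r + r') • m = r • m + r' • m
  protected mul_smul : ∀ (r r' : R) (m : M), (r * r') • m = r • r' • m

/-- The regular left module of a ring without unit. -/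
instance (R : Type*) [NonUnitalRing R] : NonUnitalModule R R where
  smul_add := mul_add
  add_smul := add_mul
  mul_smul := mul_assoc

section Firm

variable (R : Type*) [NonUnitalRing R]

/-- The multiplication map `R ⊗_R M → M`. -/
def actionMap (M : Type*) [AddCommGroup M] [NonUnitalModule R M] : BTensor R R M →+ M :=
  blift R (fun r m => r • m) NonUnitalModule.add_smul NonUnitalModule.smul_add
    (fun s r m => by rw [op_smul_eq_mul, NonUnitalModule.mul_smul])

/-- `M` is a firm left `R`-module. -/
def IsFirmModule (M : Type*) [AddCommGroup M] [NonUnitalModule R M] : Prop :=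
  Function.Bijective (actionMap R M)

/-- `R` is a firm ring: the multiplication `R ⊗_R R → R` is bijective. -/
def IsFirmRing : Prop := IsFirmModule R R

end Firm

/-! ### The dual, the elementary ring, firm projectivity -/

section Bimodule

variable {A R X : Type*} [Ring A] [NonUnitalRing R] [AddCommGroup X]
  [Module Aᵐᵒᵖ X] [NonUnitalModule R X] [SMulCommClass R Aᵐᵒᵖ X]

/-- On an `R`-`A`-bimodule `X`, the right `A`-linear map `x ↦ r x`. -/
def lact (A : Type*) {R X : Type*} [Ring A] [NonUnitalRing R] [AddCommGroup X]
    [Module Aᵐᵒᵖ X] [NonUnitalModule R X] [SMulCommClass R Aᵐᵒᵖ X] (r : R) : X →ₗ[Aᵐᵒᵖ] X where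
  toFun x := r • x
  map_add' := NonUnitalModule.smul_add r
  map_smul' a x := smul_comm r a x

@[simp]
theorem lact_apply (r : R) (x : X) : lact A r x = r • x := rfl

/-- The right `R`-action on `Hom_A(X, M)`: `(f r)(x) = f (r x)`. -/
instance homRightAction {M : Type*} [AddCommGroup M] [Module Aᵐᵒᵖ M] :
    SMul Rᵐᵒᵖ (X →ₗ[Aᵐᵒᵖ] M) where
  smul r f := f.comp (lact A (unop r))

theorem hom_op_smul_apply {M : Type*} [AddCommGroup M] [Module Aᵐᵒᵖ M] (r : R)
    (f : X →ₗ[Aᵐᵒᵖ] M) (x : X) : (op r • f) x = f (r • x) := rfl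

instance {M : Type*} [AddCommGroup M] [Module A M] [Module Aᵐᵒᵖ M] [SMulCommClass A Aᵐᵒᵖ M]
    [SMulCommClass Aᵐᵒᵖ A M] : SMulCommClass A Rᵐᵒᵖ (X →ₗ[Aᵐᵒᵖ] M) where
  smul_comm _ _ _ := rfl

end Bimodule

section Elementary

variable (A : Type*) [Ring A] (X : Type*) [AddCommGroup X] [Module Aᵐᵒᵖ X]

/-- The dual `X^* = Hom_A(X, A)` of a right `A`-module, a left `A`-module by `(a f)(x) = a f(x)`. -/
abbrev Dual : Type _ := X →ₗ[Aᵐᵒᵖ] A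

/-- The underlying additive group of the elementary ring `Z = X ⊗_A X^*`. -/
abbrev Elem : Type _ := ATensor A X (Dual A X)

variable {A X}

/-- The rank one map `v ↦ u φ(v)`. -/
def rankOne (u : X) (φ : Dual A X) : X →ₗ[Aᵐᵒᵖ] X where
  toFun v := op (φ v) • u
  map_add' v w := by rw [map_add, op_add, add_smul]
  map_smul' a v := by
    rw [map_smul, RingHom.id_apply, ← mul_smul]
    rfl

@[simp]
theorem rankOne_apply (u : X) (φ : Dual A X) (v : X) : rankOne u φ v = op (φ v) • u := rfl

/-- The action of `Z = X ⊗_A X^*` on `X`: `(u ⊗ φ) v = u φ(v)`. -/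
def elemAct : Elem A X →+ (X →ₗ[Aᵐᵒᵖ] X) :=
  blift A rankOne
    (fun u u' φ => by ext v; simp)
    (fun u φ ψ => by ext v; simp [add_smul])
    (fun a u φ => by ext v; simp [mul_smul])

@[simp]
theorem elemAct_btmul (u : X) (φ : Dual A X) (v : X) :
    elemAct (btmul A u φ) v = op (φ v) • u := rfl

/-- Multiplication on `Z`: `z (v ⊗ ψ) = (z v) ⊗ ψ`; in particular
`(u ⊗ φ)(v ⊗ ψ) = u φ(v) ⊗ ψ`. -/
def elemMul (z w : Elem A X) : Elem A X := bmap (elemAct z) LinearMap.id w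

theorem elemMul_btmul (z : Elem A X) (v : X) (ψ : Dual A X) :
    elemMul z (btmul A v ψ) = btmul A (elemAct z v) ψ := rfl

theorem elemMul_add (z w w' : Elem A X) : elemMul z (w + w') = elemMul z w + elemMul z w' :=
  map_add _ w w'

theorem add_elemMul (z z' w : Elem A X) : elemMul (z + z') w = elemMul z w + elemMul z' w := by
  induction w using btensor_induction with
  | h0 => simp [elemMul]
  | ht v ψ => simp only [elemMul_btmul, map_add, LinearMap.add_apply, add_btmul]
  | ha x y hx hy => simp only [elemMul_add, hx, hy]; abel

theorem elemAct_mul (z w : Elem A X) (x : X) :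
    elemAct (elemMul z w) x = elemAct z (elemAct w x) := by
  induction w using btensor_induction with
  | h0 => simp [elemMul]
  | ht v ψ => rw [elemMul_btmul, elemAct_btmul, elemAct_btmul, map_smul]
  | ha u v hu hv => simp only [elemMul_add, map_add, LinearMap.add_apply, hu, hv]

/-- The elementary ring `Z = X ⊗_A X^*`, in general without unit. -/
instance : NonUnitalRing (Elem A X) where
  mul := elemMul
  left_distrib := elemMul_add
  right_distrib := add_elemMul
  zero_mul w := by
    change elemMul 0 w = 0
    have h := add_elemMul 0 0 w
    rwa [add_zero, left_eq_add] at h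
  mul_zero z := map_zero (bmap (elemAct z) LinearMap.id)
  mul_assoc z w y := by
    change elemMul (elemMul z w) y = elemMul z (elemMul w y)
    induction y using btensor_induction with
    | h0 => exact (map_zero (bmap _ _)).trans (map_zero (bmap _ _)).symm
    | ht v ψ => simp only [elemMul_btmul, elemAct_mul]
    | ha u v hu hv => simp only [elemMul_add, hu, hv]

theorem btmul_mul_btmul (u v : X) (φ ψ : Dual A X) :
    (btmul A u φ * btmul A v ψ : Elem A X) = btmul A (op (φ v) • u) ψ := rfl

variable (A X)

/-- A witness that the `R`-`A`-bimodule `X` is `R`-firmly projective: a ring morphism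
`ι : R → X ⊗_A X^*` inducing the given `R`-action on `X`, for which `X` is firm. -/
structure FirmlyProjective (R : Type*) [NonUnitalRing R] [NonUnitalModule R X] where
  /-- the ring morphism -/
  ι : R →ₙ+* Elem A X
  act_eq : ∀ (r : R) (x : X), elemAct (ι r) x = r • x
  firm : IsFirmModule R X

end Elementary

/-! ### The comatrix coring -/

section Comatrix

variable (A R X : Type*) [Ring A] [NonUnitalRing R] [AddCommGroup X]
  [Module Aᵐᵒᵖ X] [NonUnitalModule R X] [SMulCommClass R Aᵐᵒᵖ X]

/-- The `A`-bimodule `X^* ⊗_R X`. -/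
abbrev Comatrix : Type _ := BTensor R (Dual A X) X

variable {A R X}

/-- For `φ ∈ Hom_A(X, M)`, the right `A`-linear map `X → Hom_A(X, M) ⊗_R X`, `u ↦ φ ⊗ u`. -/
def tensL {M : Type*} [AddCommGroup M] [Module Aᵐᵒᵖ M] (φ : X →ₗ[Aᵐᵒᵖ] M) :
    X →ₗ[Aᵐᵒᵖ] BTensor R (X →ₗ[Aᵐᵒᵖ] M) X where
  toFun u := btmul R φ u
  map_add' := btmul_add R φ
  map_smul' _ _ := rfl

/-- For `u ∈ X`, the left `A`-linear map `X^* → X^* ⊗_R X`, `f ↦ f ⊗ u`. -/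
def tensR (u : X) : Dual A X →ₗ[A] Comatrix A R X where
  toFun f := btmul R f u
  map_add' f g := add_btmul R f g u
  map_smul' _ _ := rfl

@[simp]
theorem tensL_apply {M : Type*} [AddCommGroup M] [Module Aᵐᵒᵖ M] (φ : X →ₗ[Aᵐᵒᵖ] M) (u : X) :
    tensL (R := R) φ u = btmul R φ u := rfl

@[simp]
theorem tensR_apply (f : Dual A X) (u : X) : tensR (R := R) u f = btmul R f u := rfl

namespace FirmlyProjective

/-- The inverse `d : X → R ⊗_R X` of the multiplication map. -/
noncomputable def d (P : FirmlyProjective A X R) : X ≃+ BTensor R R X :=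
  (AddEquiv.ofBijective (actionMap R X) P.firm).symm

theorem d_smul (P : FirmlyProjective A X R) (r : R) (u : X) : P.d (r • u) = btmul R r u := by
  unfold d
  rw [AddEquiv.symm_apply_eq]
  rfl

theorem smul_induction (P : FirmlyProjective A X R) {p : X → Prop} (x : X) (h0 : p 0)
    (hs : ∀ (r : R) u, p (r • u)) (ha : ∀ x y, p x → p y → p (x + y)) : p x := by
  obtain ⟨z, rfl⟩ := P.d.symm.surjective x
  induction z using btensor_induction with
  | h0 => rw [map_zero]; exact h0
  | ht r u => exact hs r u
  | ha x y hx hy => rw [map_add]; exact ha _ _ hx hy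

theorem elemMul_right (P : FirmlyProjective A X R) (z : Elem A X) (s : R) (u : X) :
    bmap LinearMap.id (tensR (R := R) u) (z * P.ι s) =
      bmap LinearMap.id (tensR (R := R) (s • u)) z := by
  induction z using btensor_induction with
  | h0 => rw [zero_mul, map_zero, map_zero]
  | ht e f =>
    have h : ∀ w : Elem A X, (btmul A e f * w : Elem A X) = btmul A e (f.comp (elemAct w)) := by
      intro w
      induction w using btensor_induction with
      | h0 =>
        rw [mul_zero, map_zero, LinearMap.comp_zero, btmul_zero]
      | ht v ψ =>
        rw [btmul_mul_btmul, btmul_balanced]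
        congr 1
        ext x
        simp
      | ha x y hx hy => rw [mul_add, hx, hy, map_add, LinearMap.comp_add, btmul_add]
    have h' : f.comp (elemAct (P.ι s)) = op s • f := by
      ext x
      rw [LinearMap.comp_apply, P.act_eq, hom_op_smul_apply]
    rw [h, h', bmap_btmul, bmap_btmul, tensR_apply, tensR_apply, btmul_balanced]
  | ha x y hx hy => rw [add_mul, map_add, map_add, hx, hy]

/-- The ring morphism `ι` as an additive map. -/
def ιAdd (P : FirmlyProjective A X R) : R →+ Elem A X := AddMonoidHom.mk' P.ι (map_add P.ι)

theorem elemAct_ιAdd (P : FirmlyProjective A X R) (s : R) : elemAct (P.ιAdd s) = lact A s := by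
  ext x
  exact P.act_eq s x

theorem ιAdd_mul (P : FirmlyProjective A X R) (s r : R) :
    P.ιAdd (s * r) = bmap (lact A s) LinearMap.id (P.ιAdd r) := by
  rw [← elemAct_ιAdd]
  exact map_mul P.ι s r

theorem ιAdd_mul_right (P : FirmlyProjective A X R) (r s : R) (u : X) :
    bmap LinearMap.id (tensR (R := R) u) (P.ιAdd (op s • r)) =
      bmap LinearMap.id (tensR (R := R) (s • u)) (P.ιAdd r) := by
  have h : P.ιAdd (op s • r) = P.ι r * P.ι s := map_mul P.ι r s
  rw [h]
  exact P.elemMul_right (P.ι r) s u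

theorem bmap_tensR_smul (a : A) (v : X) (z : Elem A X) :
    bmap LinearMap.id (tensR (R := R) (op a • v)) z =
      op a • bmap LinearMap.id (tensR (R := R) v) z := by
  induction z using btensor_induction with
  | h0 => simp
  | ht e f => rfl
  | ha x y hx hy => simp only [map_add, smul_add, hx, hy]

theorem bmap_tensL_add (φ ψ : Dual A X) (w : ATensor A X (Comatrix A R X)) :
    bmap (tensL (R := R) (φ + ψ)) LinearMap.id w =
      bmap (tensL (R := R) φ) LinearMap.id w + bmap (tensL (R := R) ψ) LinearMap.id w := by
  induction w using btensor_induction with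
  | h0 => simp
  | ht e z => simp [add_btmul]
  | ha x y hx hy => simp only [map_add, hx, hy]; abel

theorem bmap_tensL_smul (a : A) (φ : Dual A X) (w : ATensor A X (Comatrix A R X)) :
    bmap (tensL (R := R) (a • φ)) LinearMap.id w =
      a • bmap (tensL (R := R) φ) LinearMap.id w := by
  induction w using btensor_induction with
  | h0 => simp
  | ht e z => rfl
  | ha x y hx hy => simp only [map_add, smul_add, hx, hy]

theorem bmap_tensR_add {M : Type*} [AddCommGroup M] [Module Aᵐᵒᵖ M] (u v : X)
    (z : ATensor A M (Dual A X)) :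
    bmap LinearMap.id (tensR (R := R) (u + v)) z =
      bmap LinearMap.id (tensR (R := R) u) z + bmap LinearMap.id (tensR (R := R) v) z := by
  induction z using btensor_induction with
  | h0 => simp
  | ht e f => simp [btmul_add]
  | ha x y hx hy => simp only [map_add, hx, hy]; abel

/-- The map `R ⊗_R X → X ⊗_A (X^* ⊗_R X)`, `r ⊗ u ↦ e_r ⊗ (f_r ⊗ u)`, where
`ι r = e_r ⊗ f_r`. -/
noncomputable def unitMap (P : FirmlyProjective A X R) :
    BTensor R R X →+ ATensor A X (Comatrix A R X) :=
  blift R (fun r u => bmap LinearMap.id (tensR u) (P.ιAdd r))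
    (fun r r' u => by rw [map_add, map_add])
    (fun r u u' => bmap_tensR_add u u' _)
    (fun s r u => ιAdd_mul_right P r s u)

theorem unitMap_btmul (P : FirmlyProjective A X R) (r : R) (u : X) :
    P.unitMap (btmul R r u) = bmap LinearMap.id (tensR u) (P.ιAdd r) := rfl

/-- The coaction of the comatrix coring on `X` as an additive map. -/
noncomputable def coactAux (P : FirmlyProjective A X R) : X →+ ATensor A X (Comatrix A R X) :=
  AddMonoidHom.comp P.unitMap P.d.toAddMonoidHom

theorem coactAux_smul (P : FirmlyProjective A X R) (r : R) (u : X) :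
    P.coactAux (r • u) = bmap LinearMap.id (tensR u) (P.ιAdd r) := by
  rw [← P.unitMap_btmul, ← P.d_smul]
  rfl

/-- The coaction `u ↦ e_r ⊗ (f_r ⊗ u^r)` of the comatrix coring on `X`, where
`d u = r ⊗ u^r` and `ι r = e_r ⊗ f_r`. -/
noncomputable def coact (P : FirmlyProjective A X R) :
    X →ₗ[Aᵐᵒᵖ] ATensor A X (Comatrix A R X) where
  toFun := P.coactAux
  map_add' := map_add _
  map_smul' a u := by
    induction u using P.smul_induction with
    | h0 => simp
    | hs r v =>
      rw [← smul_comm r a v, coactAux_smul, coactAux_smul, RingHom.id_apply]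
      exact bmap_tensR_smul (unop a) v _
    | ha x y hx hy => simp only [smul_add, map_add, hx, hy]

theorem coact_smul (P : FirmlyProjective A X R) (r : R) (u : X) :
    P.coact (r • u) = bmap LinearMap.id (tensR u) (P.ιAdd r) := P.coactAux_smul r u

theorem coact_smul_left (P : FirmlyProjective A X R) (s : R) (u : X) :
    P.coact (s • u) = bmap (lact A s) LinearMap.id (P.coact u) := by
  induction u using P.smul_induction with
  | h0 =>
    have h : s • (0 : X) = 0 := map_zero (lact A s)
    rw [h, map_zero, map_zero]
  | hs r v =>
    rw [← NonUnitalModule.mul_smul, coact_smul, coact_smul, P.ιAdd_mul]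
    generalize P.ιAdd r = z
    induction z using btensor_induction with
    | h0 => simp
    | ht e f => rfl
    | ha x y hx hy => simp only [map_add, hx, hy]
  | ha x y hx hy => rw [NonUnitalModule.smul_add, map_add, map_add, map_add, hx, hy]

/-- The comultiplication `φ ⊗ u ↦ (φ ⊗ e_r) ⊗ (f_r ⊗ u^r)` as an additive map. -/
noncomputable def comulAux (P : FirmlyProjective A X R) :
    Comatrix A R X →+ ATensor A (Comatrix A R X) (Comatrix A R X) :=
  blift R (fun φ u => bmap (tensL φ) LinearMap.id (P.coact u))
    (fun φ φ' u => bmap_tensL_add φ φ' _)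
    (fun φ u u' => by rw [map_add, map_add])
    (fun s φ u => by
      rw [coact_smul_left]
      induction P.coact u using btensor_induction with
      | h0 => simp
      | ht e z => simp [btmul_balanced]
      | ha x y hx hy => simp only [map_add, hx, hy])

theorem comulAux_btmul (P : FirmlyProjective A X R) (φ : Dual A X) (u : X) :
    P.comulAux (btmul R φ u) = bmap (tensL φ) LinearMap.id (P.coact u) := rfl

/-- The comultiplication `φ ⊗ u ↦ (φ ⊗ e_r) ⊗ (f_r ⊗ u^r)` of the comatrix coring. -/
noncomputable def comul (P : FirmlyProjective A X R) :
    BimodHom A (Comatrix A R X) (ATensor A (Comatrix A R X) (Comatrix A R X)) where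
  toFun := P.comulAux
  map_add' := map_add _
  map_smul' a z := by
    induction z using btensor_induction with
    | h0 => simp
    | ht φ u =>
      rw [smul_btmul, comulAux_btmul, comulAux_btmul, RingHom.id_apply]
      exact bmap_tensL_smul a φ _
    | ha x y hx hy => simp only [smul_add, map_add, hx, hy]
  map_op_smul' a z := by
    change P.comulAux _ = _ • P.comulAux _
    induction z using btensor_induction with
    | h0 => simp
    | ht φ u =>
      rw [op_smul_btmul, comulAux_btmul, comulAux_btmul, map_smul]
      induction P.coact u using btensor_induction with
      | h0 => simp
      | ht e z => rfl
      | ha x y hx hy => simp only [map_add, smul_add, hx, hy]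
    | ha x y hx hy => simp only [smul_add, map_add, hx, hy]

theorem comul_btmul (P : FirmlyProjective A X R) (φ : Dual A X) (u : X) :
    P.comul (btmul R φ u) = bmap (tensL φ) LinearMap.id (P.coact u) := rfl

end FirmlyProjective

variable (A R X)

/-- The evaluation `X^* ⊗_R X → A`, `φ ⊗ u ↦ φ(u)`. -/
def evalMap : BimodHom A (Comatrix A R X) A where
  toFun := blift R (fun φ u => φ u) (fun _ _ _ => rfl) (fun φ u v => map_add φ u v)
    (fun _ _ _ => rfl)
  map_add' := map_add _
  map_smul' a z := by
    induction z using btensor_induction with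
    | h0 => simp
    | ht φ u => rfl
    | ha x y hx hy => simp only [smul_add, map_add, hx, hy]
  map_op_smul' a z := by
    induction z using btensor_induction with
    | h0 => simp
    | ht φ u => exact map_smul φ (op a) u
    | ha x y hx hy => simp only [smul_add, map_add, hx, hy]

theorem evalMap_btmul (φ : Dual A X) (u : X) : evalMap A R X (btmul R φ u) = φ u := rfl

variable {A R X}

namespace FirmlyProjective

/-- The map `z ↦ e ⊗ ((f ⊗ x) ⊗ y)` for `w = x ⊗ y`, `z = e ⊗ f`. -/
def auxR (w : ATensor A X (Comatrix A R X)) :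
    Elem A X →+ ATensor A X (ATensor A (Comatrix A R X) (Comatrix A R X)) :=
  blift A (fun e f => btmul A e (bmap (tensL (R := R) f) LinearMap.id w))
    (fun _ _ _ => add_btmul _ _ _ _)
    (fun e f f' => by rw [bmap_tensL_add, btmul_add])
    (fun a e f => by rw [btmul_balanced, bmap_tensL_smul])

theorem auxR_btmul (w : ATensor A X (Comatrix A R X)) (e : X) (f : Dual A X) :
    auxR w (btmul A e f) = btmul A e (bmap (tensL (R := R) f) LinearMap.id w) := rfl

theorem auxR_zero (z : Elem A X) : auxR (0 : ATensor A X (Comatrix A R X)) z = 0 := by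
  induction z using btensor_induction with
  | h0 => rw [map_zero]
  | ht e f => rw [auxR_btmul, map_zero, btmul_zero]
  | ha x y hx hy => rw [map_add, hx, hy, add_zero]

theorem auxR_add (w w' : ATensor A X (Comatrix A R X)) (z : Elem A X) :
    auxR (w + w') z = auxR w z + auxR w' z := by
  induction z using btensor_induction with
  | h0 => rw [map_zero, map_zero, map_zero, add_zero]
  | ht e f => rw [auxR_btmul, auxR_btmul, auxR_btmul, map_add, btmul_add]
  | ha x y hx hy => rw [map_add, map_add, map_add, hx, hy]; abel

theorem auxR_assoc (z : Elem A X) (x : X) (y : Comatrix A R X) :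
    bassoc (A := A) X (Comatrix A R X) (Comatrix A R X)
      (btmul A (bmap LinearMap.id (tensR (R := R) x) z) y) = auxR (btmul A x y) z := by
  induction z using btensor_induction with
  | h0 => rw [map_zero, map_zero, zero_btmul, map_zero]
  | ht e f => rfl
  | ha u v hu hv => rw [map_add, map_add, add_btmul, map_add, hu, hv]

theorem bmap_comul_eq (P : FirmlyProjective A X R) (u : X) (z : Elem A X) :
    bmap LinearMap.id P.comul.left (bmap LinearMap.id (tensR (R := R) u) z) =
      auxR (P.coact u) z := by
  induction z using btensor_induction with
  | h0 => rw [map_zero, map_zero, map_zero]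
  | ht e f => rfl
  | ha x y hx hy => rw [map_add, map_add, map_add, hx, hy]

theorem bmap_coact_eq (P : FirmlyProjective A X R) (r : R)
    (w : ATensor A X (Comatrix A R X)) :
    bassoc (A := A) X (Comatrix A R X) (Comatrix A R X)
      (bmap P.coact LinearMap.id (bmap (lact A r) LinearMap.id w)) = auxR w (P.ιAdd r) := by
  induction w using btensor_induction with
  | h0 => rw [map_zero, map_zero, map_zero, auxR_zero]
  | ht e f =>
    rw [bmap_btmul, bmap_btmul, lact_apply, P.coact_smul, ← auxR_assoc]
    rfl
  | ha x y hx hy => rw [map_add, map_add, map_add, hx, hy, auxR_add]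

theorem coact_coassoc (P : FirmlyProjective A X R) (x : X) :
    bassoc (A := A) X (Comatrix A R X) (Comatrix A R X)
      (bmap P.coact LinearMap.id (P.coact x)) =
      bmap LinearMap.id P.comul.left (P.coact x) := by
  induction x using P.smul_induction with
  | h0 => rw [map_zero, map_zero, map_zero, map_zero]
  | hs r u =>
    conv_lhs => rw [P.coact_smul_left, P.bmap_coact_eq]
    rw [P.coact_smul, P.bmap_comul_eq]
  | ha x y hx hy => rw [map_add, map_add, map_add, map_add, hx, hy]

theorem comul_coassoc_aux (P : FirmlyProjective A X R) (φ : Dual A X)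
    (w : ATensor A X (Comatrix A R X)) :
    bassoc (A := A) (Comatrix A R X) (Comatrix A R X) (Comatrix A R X)
      (bmap P.comul.right LinearMap.id (bmap (tensL (R := R) φ) LinearMap.id w)) =
    bmap (tensL (R := R) φ) LinearMap.id
      (bassoc (A := A) X (Comatrix A R X) (Comatrix A R X) (bmap P.coact LinearMap.id w)) := by
  induction w using btensor_induction with
  | h0 => simp only [map_zero]
  | ht e d =>
    change bassoc (A := A) (Comatrix A R X) (Comatrix A R X) (Comatrix A R X)
      (btmul A (bmap (tensL (R := R) φ) LinearMap.id (P.coact e)) d) =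
      bmap (tensL (R := R) φ) LinearMap.id
      (bassoc (A := A) X (Comatrix A R X) (Comatrix A R X) (btmul A (P.coact e) d))
    generalize P.coact e = v
    induction v using btensor_induction with
    | h0 => simp only [map_zero, zero_btmul]
    | ht x y => rfl
    | ha x y hx hy => simp only [map_add, add_btmul, hx, hy]
  | ha x y hx hy => simp only [map_add, hx, hy]

theorem counit_left_aux (φ : Dual A X) (u : X) (z : Elem A X) :
    lunit (A := A) (Comatrix A R X) (bmap (evalMap A R X).right LinearMap.id
      (bmap (tensL (R := R) φ) LinearMap.id (bmap LinearMap.id (tensR (R := R) u) z))) =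
    btmul R (φ.comp (elemAct z) : Dual A X) u := by
  induction z using btensor_induction with
  | h0 => simp only [map_zero, LinearMap.comp_zero, zero_btmul]
  | ht e f =>
    change φ e • btmul R f u = _
    rw [smul_btmul]
    congr 1
    ext x
    simp
  | ha x y hx hy => simp only [map_add, LinearMap.comp_add, add_btmul, hx, hy]

theorem counit_right_aux (φ : Dual A X) (u : X) (z : Elem A X) :
    runit (A := A) (Comatrix A R X) (bmap LinearMap.id (evalMap A R X).left
      (bmap (tensL (R := R) φ) LinearMap.id (bmap LinearMap.id (tensR (R := R) u) z))) =
    btmul R φ (elemAct z u) := by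
  induction z using btensor_induction with
  | h0 => simp only [map_zero, LinearMap.zero_apply, btmul_zero]
  | ht e f => rfl
  | ha x y hx hy => simp only [map_add, LinearMap.add_apply, btmul_add, hx, hy]

/-- The comatrix coring `X^* ⊗_R X` of an `R`-firmly projective bimodule `X`, with
`Δ(φ ⊗ u) = (φ ⊗ e_r) ⊗ (f_r ⊗ u^r)` and `ε(φ ⊗ u) = φ(u)`. -/
noncomputable def comatrixCoring (P : FirmlyProjective A X R) : Coring A (Comatrix A R X) where
  comul := P.comul
  counit := evalMap A R X
  coassoc z := by
    induction z using btensor_induction with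
    | h0 => simp only [BimodHom.map_zero, map_zero]
    | ht φ u =>
      rw [P.comul_btmul, P.comul_coassoc_aux, P.coact_coassoc]
      generalize P.coact u = w
      induction w using btensor_induction with
      | h0 => simp only [map_zero]
      | ht e d => rfl
      | ha x y hx hy => simp only [map_add, hx, hy]
    | ha x y hx hy => simp only [BimodHom.map_add, map_add, hx, hy]
  counit_left z := by
    induction z using btensor_induction with
    | h0 => simp only [BimodHom.map_zero, map_zero]
    | ht φ u =>
      induction u using P.smul_induction with
      | h0 => simp only [btmul_zero, BimodHom.map_zero, map_zero]
      | hs r v =>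
        rw [P.comul_btmul, P.coact_smul, counit_left_aux, elemAct_ιAdd, ← btmul_balanced]
        rfl
      | ha x y hx hy => simp only [btmul_add, BimodHom.map_add, map_add, hx, hy]
    | ha x y hx hy => simp only [BimodHom.map_add, map_add, hx, hy]
  counit_right z := by
    induction z using btensor_induction with
    | h0 => simp only [BimodHom.map_zero, map_zero]
    | ht φ u =>
      induction u using P.smul_induction with
      | h0 => simp only [btmul_zero, BimodHom.map_zero, map_zero]
      | hs r v =>
        rw [P.comul_btmul, P.coact_smul, counit_right_aux, elemAct_ιAdd, lact_apply]
      | ha x y hx hy => simp only [btmul_add, BimodHom.map_add, map_add, hx, hy]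
    | ha x y hx hy => simp only [BimodHom.map_add, map_add, hx, hy]

end FirmlyProjective

end Comatrix

/-! ### Galois and comonadic-Galois comodules -/

section Galois

variable {A R C X : Type*} [Ring A] [NonUnitalRing R]
  [AddCommGroup C] [Module A C] [Module Aᵐᵒᵖ C] [SMulCommClass A Aᵐᵒᵖ C]
  [AddCommGroup X] [Module Aᵐᵒᵖ X] [NonUnitalModule R X] [SMulCommClass R Aᵐᵒᵖ X]

/-- An `R`-`𝒞` bicomodule structure on the `R`-`A`-bimodule `X`: a right `𝒞`-comodule structure
whose coaction is left `R`-linear. -/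
structure Bicomodule (R : Type*) {A C : Type*} [Ring A] [NonUnitalRing R]
    [AddCommGroup C] [Module A C] [Module Aᵐᵒᵖ C] [SMulCommClass A Aᵐᵒᵖ C]
    (𝒞 : Coring A C) (X : Type*) [AddCommGroup X] [Module Aᵐᵒᵖ X] [NonUnitalModule R X]
    [SMulCommClass R Aᵐᵒᵖ X] extends Comodule 𝒞 X where
  coact_smul : ∀ (r : R) (x : X), coact (r • x) = bmap (lact A r) LinearMap.id (coact x)

variable {𝒞 : Coring A C}

theorem Bicomodule.coact_balanced (ρ : Bicomodule R 𝒞 X) {M : Type*} [AddCommGroup M]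
    [Module Aᵐᵒᵖ M] (r : R) (f : X →ₗ[Aᵐᵒᵖ] M) (u : X) :
    bmap (op r • f) (LinearMap.id : C →ₗ[A] C) (ρ.coact u) =
      bmap f LinearMap.id (ρ.coact (r • u)) := by
  rw [ρ.coact_smul]
  generalize ρ.coact u = w
  induction w using btensor_induction with
  | h0 => simp only [map_zero]
  | ht x c => rfl
  | ha x y hx hy => simp only [map_add, hx, hy]

theorem bmap_add_left {M : Type*} [AddCommGroup M] [Module Aᵐᵒᵖ M] (f g : X →ₗ[Aᵐᵒᵖ] M)
    (w : ATensor A X C) :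
    bmap (f + g) LinearMap.id w = bmap f LinearMap.id w + bmap g LinearMap.id w := by
  induction w using btensor_induction with
  | h0 => simp only [map_zero, add_zero]
  | ht x c => simp only [bmap_btmul, LinearMap.add_apply, add_btmul]
  | ha x y hx hy => simp only [map_add, hx, hy]; abel

theorem bmap_op_smul {M : Type*} [AddCommGroup M] [Module Aᵐᵒᵖ M] (f : X →ₗ[Aᵐᵒᵖ] M) (a : Aᵐᵒᵖ)
    (w : ATensor A X C) :
    bmap f (LinearMap.id : C →ₗ[A] C) (a • w) = a • bmap f LinearMap.id w := by
  induction w using btensor_induction with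
  | h0 => simp only [map_zero, smul_zero]
  | ht x c => rfl
  | ha x y hx hy => simp only [map_add, smul_add, hx, hy]

/-- The map `can_M : Hom_A(X, M) ⊗_R X → M ⊗_A C`, `f ⊗ u ↦ f(u_[0]) ⊗ u_[1]`, additively. -/
def canMAux (ρ : Bicomodule R 𝒞 X) (M : Type*) [AddCommGroup M] [Module Aᵐᵒᵖ M] :
    BTensor R (X →ₗ[Aᵐᵒᵖ] M) X →+ ATensor A M C :=
  blift R (fun f u => bmap f LinearMap.id (ρ.coact u))
    (fun f g u => bmap_add_left f g _)
    (fun f u v => by rw [map_add, map_add])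
    (fun r f u => ρ.coact_balanced r f u)

/-- The right `A`-linear map `can_M : Hom_A(X, M) ⊗_R X → M ⊗_A C`,
`f ⊗ u ↦ f(u_[0]) ⊗ u_[1]`. -/
def canM (ρ : Bicomodule R 𝒞 X) (M : Type*) [AddCommGroup M] [Module Aᵐᵒᵖ M] :
    BTensor R (X →ₗ[Aᵐᵒᵖ] M) X →ₗ[Aᵐᵒᵖ] ATensor A M C where
  toFun := canMAux ρ M
  map_add' := map_add _
  map_smul' a z := by
    induction z using btensor_induction with
    | h0 => simp only [map_zero, smul_zero]
    | ht f u =>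
      change bmap f LinearMap.id (ρ.coact (a • u)) = a • bmap f LinearMap.id (ρ.coact u)
      rw [map_smul, bmap_op_smul]
    | ha x y hx hy => simp only [map_add, smul_add, hx, hy]

theorem canM_btmul (ρ : Bicomodule R 𝒞 X) (M : Type*) [AddCommGroup M] [Module Aᵐᵒᵖ M]
    (f : X →ₗ[Aᵐᵒᵖ] M) (u : X) :
    canM ρ M (btmul R f u) = bmap f LinearMap.id (ρ.coact u) := rfl

theorem lunit_smul (a : A) (w : ATensor A A C) :
    lunit (A := A) C (a • w) = a • lunit (A := A) C w := by
  induction w using btensor_induction with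
  | h0 => simp only [map_zero, smul_zero]
  | ht b c =>
    rw [smul_btmul, lunit_btmul, lunit_btmul, smul_eq_mul, mul_smul]
  | ha x y hx hy => simp only [map_add, smul_add, hx, hy]

theorem lunit_op_smul (a : A) (w : ATensor A A C) :
    lunit (A := A) C (op a • w) = op a • lunit (A := A) C w := by
  induction w using btensor_induction with
  | h0 => simp only [map_zero, smul_zero]
  | ht b c => rw [op_smul_btmul, lunit_btmul, lunit_btmul, smul_comm]
  | ha x y hx hy => simp only [map_add, smul_add, hx, hy]

theorem bmap_smul_left (a : A) (f : Dual A X) (w : ATensor A X C) :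
    bmap (a • f) (LinearMap.id : C →ₗ[A] C) w = a • bmap f LinearMap.id w := by
  induction w using btensor_induction with
  | h0 => simp only [map_zero, smul_zero]
  | ht x c => rfl
  | ha x y hx hy => simp only [map_add, smul_add, hx, hy]

/-- The canonical `A`-bilinear map `can : X^* ⊗_R X → C`, `f ⊗ u ↦ f(u_[0]) u_[1]`. -/
def can (ρ : Bicomodule R 𝒞 X) : BimodHom A (Comatrix A R X) C where
  toFun z := lunit (A := A) C (canM ρ A z)
  map_add' z w := by rw [map_add, map_add]
  map_smul' a z := by
    induction z using btensor_induction with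
    | h0 => simp only [map_zero, smul_zero]
    | ht f u =>
      rw [smul_btmul, canM_btmul, canM_btmul, bmap_smul_left, lunit_smul, RingHom.id_apply]
    | ha x y hx hy => simp only [map_add, smul_add, hx, hy]
  map_op_smul' a z := by rw [map_smul, lunit_op_smul]

/-- The `R`-firmly projective bicomodule `X` is an `R`-`𝒞` Galois comodule: the canonical map
`can` from the comatrix coring `X^* ⊗_R X` to `𝒞` is an isomorphism of corings. -/
def IsGalois (P : FirmlyProjective A X R) (ρ : Bicomodule R 𝒞 X) : Prop :=
  IsCoringHom P.comatrixCoring 𝒞 (can ρ) ∧ Function.Bijective (can ρ)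

end Galois

/-- The bicomodule `X` is an `R`-`𝒞` comonadic-Galois comodule: `can_M` is an isomorphism for
every right `A`-module `M`. -/
def IsComonadicGalois.{v, u, r, c, x} {A : Type u} {R : Type r} {C : Type c} {X : Type x}
    [Ring A] [NonUnitalRing R] [AddCommGroup C] [Module A C] [Module Aᵐᵒᵖ C]
    [SMulCommClass A Aᵐᵒᵖ C] [AddCommGroup X] [Module Aᵐᵒᵖ X] [NonUnitalModule R X]
    [SMulCommClass R Aᵐᵒᵖ X] {𝒞 : Coring A C} (ρ : Bicomodule R 𝒞 X) : Prop :=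
  ∀ (M : Type (max u v)) [AddCommGroup M] [Module Aᵐᵒᵖ M], Function.Bijective (canM ρ M)

end FirmGalois

universe u r c x v

/-! The comatrix coring `X^* ⊗_R X` coacts on `X` by `u ↦ e_r ⊗ (f_r ⊗ u^r)`, and `can_M` for this
coaction is an isomorphism `Hom_A(X, M) ⊗_R X ≅ M ⊗_A (X^* ⊗_R X)`, whose inverse is
`m ⊗ (φ ⊗ u) ↦ m φ(-) ⊗ u`. For any other coaction `ρ`, `can_M` is this isomorphism followed by
`M ⊗ can`, so it is bijective as soon as `can` is. Conversely, `can` is `can_A` up to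
`A ⊗_A C ≅ C`, and it is compatible with the coring structures because `ρ` is the coaction above
followed by `X ⊗ can`. -/

namespace FirmGalois

section Unital

variable {A : Type*} [Ring A] {M M' M'' N N' N'' : Type*}
  [AddCommGroup M] [AddCommGroup M'] [AddCommGroup M'']
  [AddCommGroup N] [AddCommGroup N'] [AddCommGroup N'']
  [Module Aᵐᵒᵖ M] [Module Aᵐᵒᵖ M'] [Module Aᵐᵒᵖ M'']
  [Module A N] [Module A N'] [Module A N'']

theorem bmap_id_id (z : ATensor A M N) : bmap LinearMap.id LinearMap.id z = z :=
  DFunLike.congr_fun (f := bmap LinearMap.id LinearMap.id) (g := AddMonoidHom.id _)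
    (btensor_hom_ext A fun _ _ => rfl) z

theorem bmap_bmap (f' : M' →ₗ[Aᵐᵒᵖ] M'') (g' : N' →ₗ[A] N'') (f : M →ₗ[Aᵐᵒᵖ] M') (g : N →ₗ[A] N')
    (z : ATensor A M N) : bmap f' g' (bmap f g z) = bmap (f' ∘ₗ f) (g' ∘ₗ g) z :=
  DFunLike.congr_fun (f := (bmap f' g').comp (bmap f g)) (g := bmap (f' ∘ₗ f) (g' ∘ₗ g))
    (btensor_hom_ext A fun _ _ => rfl) z

theorem bmap_bijective {f : M →ₗ[Aᵐᵒᵖ] M'} {g : N →ₗ[A] N'}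
    (hf : Function.Bijective f) (hg : Function.Bijective g) : Function.Bijective (bmap f g) := by
  obtain ⟨e, rfl⟩ : ∃ e : M ≃ₗ[Aᵐᵒᵖ] M', e.toLinearMap = f := ⟨.ofBijective f hf, rfl⟩
  obtain ⟨e', rfl⟩ : ∃ e' : N ≃ₗ[A] N', e'.toLinearMap = g := ⟨.ofBijective g hg, rfl⟩
  refine Function.bijective_iff_has_inverse.2
    ⟨bmap e.symm.toLinearMap e'.symm.toLinearMap, fun z => ?_, fun z => ?_⟩
  · rw [bmap_bmap, e.symm_comp, e'.symm_comp, bmap_id_id]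
  · rw [bmap_bmap, e.comp_symm, e'.comp_symm, bmap_id_id]

/-- The right `A`-linear map `A → M`, `a ↦ m a`: the analogue of `LinearMap.toSpanSingleton` for
right modules encoded as `Aᵐᵒᵖ`-modules, with source `A` instead of `Aᵐᵒᵖ`. -/
def toSpanSingletonOp (m : M) : A →ₗ[Aᵐᵒᵖ] M where
  toFun a := op a • m
  map_add' a b := by rw [op_add, add_smul]
  map_smul' b a := mul_smul b (op a) m

theorem toSpanSingletonOp_apply (m : M) (a : A) : toSpanSingletonOp m a = op a • m := rfl

theorem comp_toSpanSingletonOp (f : M →ₗ[Aᵐᵒᵖ] M') (m : M) :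
    f ∘ₗ toSpanSingletonOp m = toSpanSingletonOp (f m) :=
  LinearMap.ext fun a => map_smul f (op a) m

theorem toSpanSingletonOp_add (m m' : M) :
    toSpanSingletonOp (m + m') = toSpanSingletonOp m + toSpanSingletonOp (A := A) m' :=
  LinearMap.ext fun a => smul_add (op a) m m'

theorem toSpanSingletonOp_one : toSpanSingletonOp (1 : A) = LinearMap.id :=
  LinearMap.ext one_mul

theorem bmap_toSpanSingletonOp (m : M) (w : ATensor A A N) :
    bmap (toSpanSingletonOp m) LinearMap.id w = btmul A m (lunit N w) := by
  induction w using btensor_induction with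
  | h0 => simp only [map_zero, btmul_zero]
  | ht a n => exact btmul_balanced A a m n
  | ha x y hx hy => simp only [map_add, btmul_add, hx, hy]

theorem lunit_bijective : Function.Bijective (lunit (A := A) N) := by
  refine Function.bijective_iff_has_inverse.2 ⟨btmul A 1, fun w => ?_, fun n => one_smul A n⟩
  rw [← bmap_toSpanSingletonOp, toSpanSingletonOp_one, bmap_id_id]

theorem lunit_bmap_id (g : N →ₗ[A] N') (w : ATensor A A N) :
    lunit N' (bmap LinearMap.id g w) = g (lunit N w) :=
  DFunLike.congr_fun (f := (lunit N').comp (bmap LinearMap.id g))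
    (g := g.toAddMonoidHom.comp (lunit N))
    (btensor_hom_ext A fun a n => (map_smul g a n).symm) w

end Unital

section Contract

variable {A X C N : Type*} [Ring A] [AddCommGroup X] [Module Aᵐᵒᵖ X]
  [AddCommGroup C] [Module A C] [Module Aᵐᵒᵖ C] [SMulCommClass A Aᵐᵒᵖ C]
  [AddCommGroup N] [Module A N] [Module Aᵐᵒᵖ N] [SMulCommClass A Aᵐᵒᵖ N]

/-- The contraction `X ⊗_A C → C`, `x ⊗ c ↦ φ(x) c`, against a functional `φ ∈ X^*`. -/
def contract (φ : Dual A X) : ATensor A X C →ₗ[Aᵐᵒᵖ] C where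
  toFun w := lunit C (bmap φ LinearMap.id w)
  map_add' w w' := by rw [map_add, map_add]
  map_smul' a w := by
    rw [bmap_op_smul]
    exact lunit_op_smul (unop a) _

theorem contract_bmap_id (φ : Dual A X) (g : C →ₗ[A] N) (w : ATensor A X C) :
    contract φ (bmap LinearMap.id g w) = g (contract φ w) := by
  refine Eq.trans ?_ (lunit_bmap_id g (bmap φ LinearMap.id w))
  simp only [contract, LinearMap.coe_mk, AddHom.coe_mk, bmap_bmap, LinearMap.comp_id,
    LinearMap.id_comp]

theorem contract_eq_runit (φ : Dual A X) (w : ATensor A X A) : contract φ w = φ (runit X w) :=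
  DFunLike.congr_fun (f := (contract φ).toAddMonoidHom) (g := φ.toAddMonoidHom.comp (runit X))
    (btensor_hom_ext A fun x a => (map_smul φ (op a) x).symm) w

theorem contract_bassoc (φ : Dual A X) (w : ATensor A (ATensor A X C) N) :
    contract φ (bassoc X C N w) = bmap (contract φ) LinearMap.id w := by
  refine DFunLike.congr_fun (f := (contract φ).toAddMonoidHom.comp (bassoc X C N))
    (btensor_hom_ext A fun y n => ?_) w
  change contract φ (bassoc X C N (btmul A y n)) = btmul A (contract φ y) n
  induction y using btensor_induction with
  | h0 => simp only [zero_btmul, map_zero]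
  | ht x c => rfl
  | ha y y' hy hy' => simp only [add_btmul, map_add, hy, hy']

end Contract

section HomTensor

variable {A R X M M' M'' : Type*} [Ring A] [NonUnitalRing R]
  [AddCommGroup X] [Module Aᵐᵒᵖ X] [NonUnitalModule R X] [SMulCommClass R Aᵐᵒᵖ X]
  [AddCommGroup M] [AddCommGroup M'] [AddCommGroup M'']
  [Module Aᵐᵒᵖ M] [Module Aᵐᵒᵖ M'] [Module Aᵐᵒᵖ M'']

/-- The action of the functor `Hom_A(X, -) ⊗_R X` on a right `A`-linear map `g : M → M'`,
`f ⊗ u ↦ (g ∘ f) ⊗ u`. -/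
def homTensorMap (g : M →ₗ[Aᵐᵒᵖ] M') :
    BTensor R (X →ₗ[Aᵐᵒᵖ] M) X →+ BTensor R (X →ₗ[Aᵐᵒᵖ] M') X :=
  blift R (fun f u => btmul R (g ∘ₗ f) u)
    (fun f f' u => by rw [LinearMap.comp_add, add_btmul])
    (fun f u u' => btmul_add R (g ∘ₗ f) u u')
    (fun r f u => btmul_balanced R r (g ∘ₗ f) u)

theorem homTensorMap_btmul (g : M →ₗ[Aᵐᵒᵖ] M') (f : X →ₗ[Aᵐᵒᵖ] M) (u : X) :
    homTensorMap g (btmul R f u) = btmul R (g ∘ₗ f) u := rfl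

theorem homTensorMap_id (z : BTensor R (X →ₗ[Aᵐᵒᵖ] M) X) : homTensorMap LinearMap.id z = z :=
  DFunLike.congr_fun (f := homTensorMap LinearMap.id) (g := AddMonoidHom.id _)
    (btensor_hom_ext R fun _ _ => rfl) z

theorem homTensorMap_homTensorMap (g' : M' →ₗ[Aᵐᵒᵖ] M'') (g : M →ₗ[Aᵐᵒᵖ] M')
    (z : BTensor R (X →ₗ[Aᵐᵒᵖ] M) X) :
    homTensorMap g' (homTensorMap g z) = homTensorMap (g' ∘ₗ g) z :=
  DFunLike.congr_fun (f := (homTensorMap g').comp (homTensorMap g)) (g := homTensorMap (g' ∘ₗ g))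
    (btensor_hom_ext R fun _ _ => rfl) z

theorem homTensorMap_add (g g' : M →ₗ[Aᵐᵒᵖ] M') (z : BTensor R (X →ₗ[Aᵐᵒᵖ] M) X) :
    homTensorMap (g + g') z = homTensorMap g z + homTensorMap g' z :=
  DFunLike.congr_fun (g := homTensorMap g + homTensorMap g')
    (btensor_hom_ext R fun f u => add_btmul R (g ∘ₗ f) (g' ∘ₗ f) u) z

theorem homTensorMap_bijective (e : M ≃ₗ[Aᵐᵒᵖ] M') :
    Function.Bijective (homTensorMap (R := R) (X := X) e.toLinearMap) := by
  refine Function.bijective_iff_has_inverse.2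
    ⟨homTensorMap e.symm.toLinearMap, fun z => ?_, fun z => ?_⟩
  · rw [homTensorMap_homTensorMap, e.symm_comp, homTensorMap_id]
  · rw [homTensorMap_homTensorMap, e.comp_symm, homTensorMap_id]

theorem homTensorMap_toSpanSingletonOp (a : A) (z : Comatrix A R X) :
    homTensorMap (toSpanSingletonOp a) z = a • z :=
  DFunLike.congr_fun (g := DistribSMul.toAddMonoidHom (Comatrix A R X) a)
    (btensor_hom_ext R fun _ _ => rfl) z

variable (A R X M) in
/-- The natural map `M ⊗_A (X^* ⊗_R X) → Hom_A(X, M) ⊗_R X`, `m ⊗ (φ ⊗ u) ↦ m φ(-) ⊗ u`. -/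
def homTensorOfComatrix : ATensor A M (Comatrix A R X) →+ BTensor R (X →ₗ[Aᵐᵒᵖ] M) X :=
  blift A (fun m z => homTensorMap (toSpanSingletonOp (A := A) m) z)
    (fun m m' z => by rw [toSpanSingletonOp_add, homTensorMap_add])
    (fun m z z' => map_add (homTensorMap (toSpanSingletonOp (A := A) m)) z z')
    (fun a m z => by
      rw [← homTensorMap_toSpanSingletonOp, homTensorMap_homTensorMap, comp_toSpanSingletonOp,
        toSpanSingletonOp_apply])

theorem homTensorOfComatrix_btmul (m : M) (z : Comatrix A R X) :
    homTensorOfComatrix A R X M (btmul A m z) = homTensorMap (toSpanSingletonOp m) z := rfl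

theorem homTensorOfComatrix_bmap (g : M →ₗ[Aᵐᵒᵖ] M') (w : ATensor A M (Comatrix A R X)) :
    homTensorOfComatrix A R X M' (bmap g LinearMap.id w) =
      homTensorMap g (homTensorOfComatrix A R X M w) := by
  refine DFunLike.congr_fun (f := (homTensorOfComatrix A R X M').comp (bmap g LinearMap.id))
    (g := (homTensorMap g).comp (homTensorOfComatrix A R X M)) (btensor_hom_ext A fun m z => ?_) w
  simp only [AddMonoidHom.comp_apply, bmap_btmul, homTensorOfComatrix_btmul, LinearMap.id_apply,
    homTensorMap_homTensorMap, comp_toSpanSingletonOp]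

theorem homTensorOfComatrix_self (w : ATensor A A (Comatrix A R X)) :
    homTensorOfComatrix A R X A w = lunit (Comatrix A R X) w :=
  DFunLike.congr_fun (btensor_hom_ext A homTensorMap_toSpanSingletonOp) w

theorem homTensorOfComatrix_bmap_tensR (u : X) (z : Elem A X) :
    homTensorOfComatrix A R X X (bmap LinearMap.id (tensR u) z) = btmul R (elemAct z) u := by
  induction z using btensor_induction with
  | h0 => simp only [map_zero, zero_btmul]
  | ht e φ => rfl
  | ha x y hx hy => simp only [map_add, add_btmul, hx, hy]

end HomTensor

section Galois

variable {A R C X : Type*} [Ring A] [NonUnitalRing R]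
  [AddCommGroup C] [Module A C] [Module Aᵐᵒᵖ C] [SMulCommClass A Aᵐᵒᵖ C]
  [AddCommGroup X] [Module Aᵐᵒᵖ X] [NonUnitalModule R X] [SMulCommClass R Aᵐᵒᵖ X]
  {𝒞 : Coring A C} {M M' : Type*} [AddCommGroup M] [Module Aᵐᵒᵖ M]
  [AddCommGroup M'] [Module Aᵐᵒᵖ M']

theorem canM_homTensorMap (ρ : Bicomodule R 𝒞 X) (g : M →ₗ[Aᵐᵒᵖ] M')
    (z : BTensor R (X →ₗ[Aᵐᵒᵖ] M) X) :
    canM ρ M' (homTensorMap g z) = bmap g LinearMap.id (canM ρ M z) :=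
  DFunLike.congr_fun (f := (canM ρ M').toAddMonoidHom.comp (homTensorMap g))
    (g := (bmap g LinearMap.id).comp (canM ρ M).toAddMonoidHom)
    (btensor_hom_ext R fun f u => (bmap_bmap g LinearMap.id f LinearMap.id (ρ.coact u)).symm) z

theorem canM_bijective_congr (ρ : Bicomodule R 𝒞 X) (e : M ≃ₗ[Aᵐᵒᵖ] M') :
    Function.Bijective (canM ρ M) ↔ Function.Bijective (canM ρ M') := by
  have square : canM ρ M' ∘ homTensorMap e.toLinearMap =
      bmap e.toLinearMap LinearMap.id ∘ canM ρ M := funext (canM_homTensorMap ρ e.toLinearMap)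
  have he : Function.Bijective (bmap e.toLinearMap (LinearMap.id : C →ₗ[A] C)) :=
    bmap_bijective e.bijective Function.bijective_id
  rw [← Function.Bijective.of_comp_iff (canM ρ M') (homTensorMap_bijective e), square,
    Function.Bijective.of_comp_iff' he]

theorem can_bijective_iff (ρ : Bicomodule R 𝒞 X) :
    Function.Bijective (can ρ) ↔ Function.Bijective (canM ρ A) :=
  Function.Bijective.of_comp_iff' lunit_bijective (canM ρ A)

theorem canM_homTensorOfComatrix (ρ : Bicomodule R 𝒞 X) (w : ATensor A M (Comatrix A R X)) :
    canM ρ M (homTensorOfComatrix A R X M w) = bmap LinearMap.id (can ρ).left w := by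
  refine DFunLike.congr_fun
    (f := (canM ρ M).toAddMonoidHom.comp (homTensorOfComatrix A R X M))
    (btensor_hom_ext A fun m z => ?_) w
  exact (canM_homTensorMap ρ _ z).trans (bmap_toSpanSingletonOp m (canM ρ A z))

theorem counit_can (ρ : Bicomodule R 𝒞 X) (z : Comatrix A R X) :
    𝒞.counit (can ρ z) = evalMap A R X z := by
  refine DFunLike.congr_fun
    (f := (𝒞.counit.left ∘ₗ (can ρ).left).toAddMonoidHom)
    (g := (evalMap A R X).left.toAddMonoidHom) (btensor_hom_ext R fun φ u => ?_) z
  calc 𝒞.counit.left (contract φ (ρ.coact u))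
      = φ (runit X (bmap LinearMap.id 𝒞.counit.left (ρ.coact u))) := by
        rw [← contract_bmap_id, contract_eq_runit]
    _ = φ u := by rw [ρ.counit]

theorem comul_can_btmul (ρ : Bicomodule R 𝒞 X) (φ : Dual A X) (u : X) :
    𝒞.comul (can ρ (btmul R φ u)) =
      bmap ((can ρ).right ∘ₗ tensL φ) LinearMap.id (ρ.coact u) :=
  calc 𝒞.comul.left (contract φ (ρ.coact u))
      = contract φ (bassoc X C C (bmap ρ.coact LinearMap.id (ρ.coact u))) := by
        rw [ρ.coassoc, contract_bmap_id]
    _ = bmap (contract φ ∘ₗ ρ.coact) LinearMap.id (ρ.coact u) := by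
        rw [contract_bassoc, bmap_bmap, LinearMap.id_comp]

namespace FirmlyProjective

theorem runit_bmap_evalMap_coact (P : FirmlyProjective A X R) (u : X) :
    runit X (bmap LinearMap.id (evalMap A R X).left (P.coact u)) = u := by
  have eval_tensR (v : X) (z : Elem A X) :
      runit X (bmap LinearMap.id (evalMap A R X).left (bmap LinearMap.id (tensR v) z)) =
        elemAct z v := by
    induction z using btensor_induction with
    | h0 => simp only [map_zero, LinearMap.zero_apply]
    | ht e φ => rfl
    | ha x y hx hy => simp only [map_add, LinearMap.add_apply, hx, hy]
  induction u using P.smul_induction with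
  | h0 => simp only [map_zero]
  | hs r v => rw [P.coact_smul, eval_tensR, P.elemAct_ιAdd, lact_apply]
  | ha x y hx hy => simp only [map_add, hx, hy]

/-- `X` as a bicomodule over its own comatrix coring, with coaction
`u ↦ e_r ⊗ (f_r ⊗ u^r)`. It is the universal case: the coaction of any other bicomodule structure
on `X` is induced from this one along `can`. -/
noncomputable def bicomodule (P : FirmlyProjective A X R) : Bicomodule R P.comatrixCoring X where
  coact := P.coact
  coassoc := P.coact_coassoc
  counit := P.runit_bmap_evalMap_coact
  coact_smul := P.coact_smul_left

theorem homTensorOfComatrix_coact (P : FirmlyProjective A X R) (u : X) :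
    homTensorOfComatrix A R X X (P.coact u) = btmul R LinearMap.id u := by
  induction u using P.smul_induction with
  | h0 => simp only [map_zero, btmul_zero]
  | hs r v =>
    rw [P.coact_smul, homTensorOfComatrix_bmap_tensR, P.elemAct_ιAdd, ← btmul_balanced]
    rfl
  | ha x y hx hy => simp only [map_add, btmul_add, hx, hy]

theorem homTensorOfComatrix_canM (P : FirmlyProjective A X R) (z : BTensor R (X →ₗ[Aᵐᵒᵖ] M) X) :
    homTensorOfComatrix A R X M (canM P.bicomodule M z) = z := by
  refine DFunLike.congr_fun
    (f := (homTensorOfComatrix A R X M).comp (canM P.bicomodule M).toAddMonoidHom)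
    (g := AddMonoidHom.id _) (btensor_hom_ext R fun f u => ?_) z
  calc homTensorOfComatrix A R X M (bmap f LinearMap.id (P.coact u))
      = homTensorMap f (btmul R LinearMap.id u) := by
        rw [homTensorOfComatrix_bmap, P.homTensorOfComatrix_coact]
    _ = btmul R f u := homTensorMap_btmul f LinearMap.id u

theorem can_bicomodule (P : FirmlyProjective A X R) (z : Comatrix A R X) :
    can P.bicomodule z = z :=
  (homTensorOfComatrix_self (canM P.bicomodule A z)).symm.trans (P.homTensorOfComatrix_canM z)

theorem canM_bicomodule_bijective (P : FirmlyProjective A X R) :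
    Function.Bijective (canM P.bicomodule M) := by
  refine Function.bijective_iff_has_inverse.2
    ⟨homTensorOfComatrix A R X M, P.homTensorOfComatrix_canM, fun w => ?_⟩
  have can_eq_id : (can P.bicomodule).left = LinearMap.id := LinearMap.ext P.can_bicomodule
  rw [canM_homTensorOfComatrix, can_eq_id, bmap_id_id]

theorem bmap_can_coact (P : FirmlyProjective A X R) (ρ : Bicomodule R 𝒞 X) (u : X) :
    bmap LinearMap.id (can ρ).left (P.coact u) = ρ.coact u := by
  rw [← canM_homTensorOfComatrix, P.homTensorOfComatrix_coact, canM_btmul, bmap_id_id]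

theorem canM_eq_bmap_can (P : FirmlyProjective A X R) (ρ : Bicomodule R 𝒞 X)
    (z : BTensor R (X →ₗ[Aᵐᵒᵖ] M) X) :
    canM ρ M z = bmap LinearMap.id (can ρ).left (canM P.bicomodule M z) := by
  rw [← canM_homTensorOfComatrix, P.homTensorOfComatrix_canM]

theorem can_isCoringHom (P : FirmlyProjective A X R) (ρ : Bicomodule R 𝒞 X) :
    IsCoringHom P.comatrixCoring 𝒞 (can ρ) where
  map_counit := counit_can ρ
  map_comul z := by
    refine DFunLike.congr_fun
      (f := (𝒞.comul.left ∘ₗ (can ρ).left).toAddMonoidHom)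
      (g := (bmap (can ρ).right (can ρ).left).comp P.comul.left.toAddMonoidHom)
      (btensor_hom_ext R fun φ u => ?_) z
    calc 𝒞.comul (can ρ (btmul R φ u))
        = bmap ((can ρ).right ∘ₗ tensL φ) (can ρ).left (P.coact u) := by
          rw [comul_can_btmul, ← P.bmap_can_coact ρ, bmap_bmap, LinearMap.comp_id,
            LinearMap.id_comp]
      _ = bmap (can ρ).right (can ρ).left (bmap (tensL φ) LinearMap.id (P.coact u)) := by
          rw [bmap_bmap, LinearMap.comp_id]

theorem canM_bijective_of_can (P : FirmlyProjective A X R) {ρ : Bicomodule R 𝒞 X}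
    (h : Function.Bijective (can ρ)) : Function.Bijective (canM ρ M) := by
  have factorization : ⇑(canM ρ M) = bmap LinearMap.id (can ρ).left ∘ canM P.bicomodule M :=
    funext (P.canM_eq_bmap_can ρ)
  rw [factorization]
  exact (bmap_bijective Function.bijective_id h).comp P.canM_bicomodule_bijective

end FirmlyProjective

end Galois

end FirmGalois

theorem theorem4p2_general {A : Type u} {R : Type r} {C : Type c} {X : Type x}
    [Ring A] [NonUnitalRing R]
    [AddCommGroup C] [Module A C] [Module Aᵐᵒᵖ C] [SMulCommClass A Aᵐᵒᵖ C]
    [AddCommGroup X] [Module Aᵐᵒᵖ X] [FirmGalois.NonUnitalModule R X] [SMulCommClass R Aᵐᵒᵖ X]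
    (𝒞 : FirmGalois.Coring A C) (ρ : FirmGalois.Bicomodule R 𝒞 X)
    (P : FirmGalois.FirmlyProjective A X R) :
    FirmGalois.IsGalois P ρ ↔ FirmGalois.IsComonadicGalois.{v} ρ := by
  refine ⟨fun hGalois M _ _ => P.canM_bijective_of_can hGalois.2, fun hComonadic => ?_⟩
  refine ⟨P.can_isCoringHom ρ, (FirmGalois.can_bijective_iff ρ).2 ?_⟩
  -- `A` itself need not lie in the universe over which `M` ranges.
  exact (FirmGalois.canM_bijective_congr ρ ULift.moduleEquiv).1 (hComonadic (ULift.{v} A))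

theorem theorem4p2 {A : Type u} {R : Type r} {C : Type c} {X : Type x}
    [Ring A] [NonUnitalRing R]
    [AddCommGroup C] [Module A C] [Module Aᵐᵒᵖ C] [SMulCommClass A Aᵐᵒᵖ C]
    [AddCommGroup X] [Module Aᵐᵒᵖ X] [FirmGalois.NonUnitalModule R X] [SMulCommClass R Aᵐᵒᵖ X]
    (hR : FirmGalois.IsFirmRing R)
    (𝒞 : FirmGalois.Coring A C) (ρ : FirmGalois.Bicomodule R 𝒞 X)
    (P : FirmGalois.FirmlyProjective A X R) :
    FirmGalois.IsGalois P ρ ↔ FirmGalois.IsComonadicGalois.{v} ρ := by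
  exact theorem4p2_general 𝒞 ρ P
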